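/- **Conventions.** Identify partitions with Young diagrams. For a sequence of variables $u=(u_1,u_2,\dots)$ define $h_k(u)$ by $\sum_{k\ge 0}h_k(u)z^k=\exp\bigl(\sum_{j\ge1}u_jz^j\bigr)$ and $h_k=0$ for $k<0$. For a partition $\lambda$ of length $n$ let $S_\lambda(u)=\det\bigl(h_{\lambda_i-i+j}(u)\bigr)_{1\le i,j\le n}$; this is the Schur function expressed in the variables $u_j=p_j/j$, where $p_j$ is the $j$-th power sum. Let $\square(n,m)=(m^n)$ be the rectangular partition with $n$ rows of length $m$. Label the cell in row $i$ and column $j$ of a Young diagram (counted from $1$) with $0$ if $i+j$ is even and with $1$ if $i+j$ is odd; a cell labelled $1$ is called a $1$-node. The $2$-quotient $(\mu[0],\mu[1])$ of a partition $\mu$ is defined as follows. Write $\mu=(\mu_1,\dots,\mu_N)$ with $N$ even, adding zeros if necessary, and let $\xi_i=\mu_i+N-i$. For $k\in\{0,1\}$ let $x_1>x_2>\dots>x_{s}$ be the elements of $\{(\xi_i-k)/2 : \xi_i\equiv k \bmod 2\}$; then $\mu[k]=(x_1-(s-1),\,x_2-(s-2),\,\dots,\,x_{s})$. (The result does not depend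 on the choice of the even number $N$.) **Theorem.** Let $\ell$ be a positive odd integer and let $\Delta_\ell=(\ell,\ell-1,\dots,1)$ be the staircase partition. For $0\le m\le \ell$ let $\mathcal F_1^m(\Delta_\ell)$ be the set of partitions obtained by adding $m$ $1$-nodes to $\Delta_\ell$. Then $$\sum_{\mu\in\mathcal F_1^m(\Delta_\ell)}(-1)^{|\mu[1]|}\,S_{\mu[0]}(u)\,S_{\mu[1]}(v)=S_{\square(\ell+1-m,\,m)}(u-v),$$ where $u=(u_1,u_2,\dots)$ and $v=(v_1,v_2,\dots)$ are two sequences of variables and $u-v=(u_1-v_1,u_2-v_2,\dots)$. (The identity holds in $\mathbb Q[u_1,u_2,\dots,v_1,v_2,\dots]$, hence for all sequences $u,v$ in any commutative $\mathbb Q$-algebra.) -/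

import Mathlib

namespace RectSchur

open Finset

noncomputable section

/-! ### Schur functions in the Sato variables `u_j = p_j / j`, `j ≥ 1` -/

/-- The power series `u_1 z + u_2 z ^ 2 + u_3 z ^ 3 + ⋯` in `z`, whose coefficients are the
independent variables `u_1, u_2, …`. -/
def satoSeries : PowerSeries (MvPolynomial ℕ+ ℚ) :=
  PowerSeries.mk fun j => if hj : 0 < j then MvPolynomial.X ⟨j, hj⟩ else 0

/-- The complete homogeneous symmetric function `h_k` in the Sato variables: the coefficient of
`z ^ k` in `exp (u_1 z + u_2 z ^ 2 + ⋯)`, with `h_k = 0` for `k < 0`. -/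
def completeHomogeneous (k : ℤ) : MvPolynomial ℕ+ ℚ :=
  if 0 ≤ k then
    PowerSeries.coeff k.toNat
      (PowerSeries.subst satoSeries (PowerSeries.exp (MvPolynomial ℕ+ ℚ)))
  else 0

/-- The Schur function `S_lam (u)`, a polynomial in the Sato variables `u_1, u_2, …`: the
determinant of `h_{lam_i - i + j} (u)`, where `i` and `j` run over the rows of `lam`. -/
def schur (lam : YoungDiagram) : MvPolynomial ℕ+ ℚ :=
  Matrix.det (Matrix.of fun i j : Fin (lam.colLen 0) =>
    completeHomogeneous ((lam.rowLen i : ℤ) - (i : ℤ) + (j : ℤ)))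

/-! ### Special diagrams -/

/-- The rectangular diagram `□(n, m) = (m ^ n)`, with `n` rows of length `m`. -/
def rectangle (n m : ℕ) : YoungDiagram where
  cells := range n ×ˢ range m
  isLowerSet := by
    rintro ⟨a, b⟩ ⟨c, d⟩ ⟨h1, h2⟩ h
    simp only [coe_product, coe_range, Set.mem_prod, Set.mem_Iio] at h ⊢
    exact ⟨lt_of_le_of_lt h1 h.1, lt_of_le_of_lt h2 h.2⟩

/-- The staircase `Δ_l = (l, l - 1, …, 1)`. -/
def staircase (l : ℕ) : YoungDiagram where
  cells := (range l ×ˢ range l).filter fun c => c.1 + c.2 < l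
  isLowerSet := by
    rintro ⟨a, b⟩ ⟨c, d⟩ ⟨h1, h2⟩ h
    simp only [coe_filter, mem_product, mem_range, Set.mem_ofPred_eq] at h h1 h2 ⊢
    omega

/-! ### Adding nodes -/

/-- The number, `0` or `1`, written in the cell `c`: the parity of row index plus column index.
(Rows and columns are counted from `0` here; counting both from `1` gives the same parity.) -/
def nodeLabel (c : ℕ × ℕ) : ℕ := (c.1 + c.2) % 2

/-- The diagrams obtained from `lam` by adding `m` nodes, all of them labelled `i`. -/
def addedNodesSet (i m : ℕ) (lam : YoungDiagram) : Set YoungDiagram :=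
  {mu | lam ≤ mu ∧ #(mu.cells \ lam.cells) = m ∧ ∀ c ∈ mu.cells \ lam.cells, nodeLabel c = i}

theorem cells_subset_of_card_le {mu : YoungDiagram} {k : ℕ} (h : mu.card ≤ k) :
    mu.cells ⊆ range k ×ˢ range k := by
  rintro ⟨a, b⟩ hab
  have hab' : (a, b) ∈ mu := hab
  have h1 : #((range (a + 1)).image fun x => (x, b)) ≤ mu.card :=
    card_le_card fun c hc => by
      obtain ⟨x, hx, rfl⟩ := mem_image.1 hc
      exact mu.up_left_mem (Nat.lt_succ_iff.1 (mem_range.1 hx)) le_rfl hab'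
  have h2 : #((range (b + 1)).image fun y => (a, y)) ≤ mu.card :=
    card_le_card fun c hc => by
      obtain ⟨y, hy, rfl⟩ := mem_image.1 hc
      exact mu.up_left_mem le_rfl (Nat.lt_succ_iff.1 (mem_range.1 hy)) hab'
  rw [card_image_of_injective _ (fun x y hxy => (Prod.mk.inj hxy).1), card_range] at h1
  rw [card_image_of_injective _ (fun x y hxy => (Prod.mk.inj hxy).2), card_range] at h2
  simp only [mem_product, mem_range]
  omega

theorem addedNodesSet_finite (i m : ℕ) (lam : YoungDiagram) :
    (addedNodesSet i m lam).Finite := by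
  refine Set.Finite.of_finite_image (f := YoungDiagram.cells)
    ((finite_toSet (range (lam.card + m) ×ˢ range (lam.card + m)).powerset).subset ?_)
    (fun a _ b _ hab => YoungDiagram.ext hab)
  rintro _ ⟨mu, ⟨hle, hcard, -⟩, rfl⟩
  refine mem_coe.2 (mem_powerset.2 (cells_subset_of_card_le ?_))
  have := card_sdiff_add_card_eq_card (YoungDiagram.cells_subset_iff.2 hle)
  change #mu.cells ≤ #lam.cells + m
  omega

/-- The finite set `F_i^m(lam)` of the diagrams obtained from `lam` by adding `m` nodes, all of
them labelled `i`. -/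
def addedNodes (i m : ℕ) (lam : YoungDiagram) : Finset YoungDiagram :=
  (addedNodesSet_finite i m lam).toFinset

/-! ### Quotients -/

/-- The strict partition `lam + (n - 1, n - 2, …, 1, 0)`, as a set, where `lam` is completed by
zeros to a vector of length `n`; meant for `n` at least the number of rows of `lam`. -/
def betaSet (n : ℕ) (lam : YoungDiagram) : Finset ℕ :=
  (range n).image fun i => lam.rowLen i + (n - 1 - i)

/-- The levels of the beads on the `k`-th runner of the `r`-abacus with bead positions `B`. -/
def runner (r k : ℕ) (B : Finset ℕ) : Finset ℕ :=
  (B.filter fun b => b % r = k).image fun b => b / r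

/-- For a finite set `x_1 > x_2 > ⋯ > x_n` of natural numbers, the partition
`(x_1, …, x_n) - (n - 1, …, 1, 0)`. Its part at `b = x_i` is `b` minus the number of smaller
elements of the set, that is, the number of holes below `b`. -/
def ofBetaSet (B : Finset ℕ) : YoungDiagram :=
  YoungDiagram.ofRowLens ((B.sort (· ≥ ·)).map fun b => #(range b \ B)) <| by
    refine List.Pairwise.sortedGE (List.pairwise_map.2 ((pairwise_sort B (· ≥ ·)).imp ?_))
    intro a b hab
    exact card_le_card (sdiff_subset_sdiff (range_subset_range.2 hab) Subset.rfl)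

/-- The component `lam[k]` of the `r`-quotient of `lam`. The number of beads is the least multiple
of `r` that is at least the number of rows of `lam`. -/
def quotient (r k : ℕ) (lam : YoungDiagram) : YoungDiagram :=
  ofBetaSet (runner r k (betaSet (r * (lam.colLen 0 ⌈/⌉ r)) lam))

end

end RectSchur

/-! For odd `l`, the `1`-nodes that can be added to the staircase are its `l + 1` outer corners, so
`mu` amounts to a set `A` of `m` elements of `{0, …, l}`. On the abacus with `l + 1` beads, adding
corner `a` moves the bead at `2a` to `2a + 1`. Runner 1 therefore carries `A` and runner 0 its
complement (`quotient_one_addCorners`, `quotient_zero_addCorners`).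

It remains to sum over `A` (`sum_schur_mul_schur_compl`). Write `E(u)` for the generating series of
the `h_k(u)` and put `n = l + 1 - m`. Stack `m` shifted coefficient rows of `E(v)` on `n` such rows
of `E(u)`. By `jacobiTrudi_ofBetaSet` the minors with columns `A` and its complement are the two
Schur functions. The Laplace sign is `(-1)` to the size of the partition with beta set `A`, so the
sum is the determinant of the stacked matrix (`det_eq_sum_mul_det_minors`).

Since `E(u) = E(u - v) E(v)`, a unitriangular Toeplitz factor of `E(v)` splits off on the right.
What is left has top rows `(I | 0)` and, at lower right, the Jacobi–Trudi matrix of the rectangle at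
`u - v` (`det_stackedToeplitz_mul`). -/

namespace RectSchur

open Finset PowerSeries

/-! ### Exponential generating series and their multiplicativity -/

section ExpSeries

variable {R : Type*} [CommRing R]

/-- The power series `∑ u_j z ^ j` with coefficients in a commutative `ℚ`-algebra. -/
noncomputable def satoSeriesAt (u : ℕ+ → R) : PowerSeries R :=
  PowerSeries.mk fun j => if hj : 0 < j then u ⟨j, hj⟩ else 0

theorem constantCoeff_satoSeriesAt (u : ℕ+ → R) : constantCoeff (satoSeriesAt u) = 0 := by
  rw [← coeff_zero_eq_constantCoeff_apply, satoSeriesAt, coeff_mk]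
  simp

theorem hasSubst_satoSeriesAt (u : ℕ+ → R) : HasSubst (satoSeriesAt u) :=
  HasSubst.of_constantCoeff_zero' (constantCoeff_satoSeriesAt u)

theorem satoSeriesAt_add (u v : ℕ+ → R) :
    satoSeriesAt (u + v) = satoSeriesAt u + satoSeriesAt v := by
  ext j
  rw [map_add, satoSeriesAt, satoSeriesAt, satoSeriesAt, coeff_mk, coeff_mk, coeff_mk]
  split_ifs
  · rfl
  · rw [add_zero]

/-- A solution of the linear differential equation `F' = F * a` over a torsion-free ring is
determined by its constant coefficient. -/
theorem eq_of_derivative_eq_mul {S : Type*} [CommRing S] [IsAddTorsionFree S]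
    {F G a : PowerSeries S} (hF : d⁄dX S F = F * a) (hG : d⁄dX S G = G * a)
    (h0 : constantCoeff F = constantCoeff G) : F = G := by
  ext n
  induction n using Nat.strong_induction_on with
  | _ n ih =>
    rcases n with _ | n
    · simpa using h0
    · have h : coeff n (F * a) = coeff n (G * a) := by
        rw [coeff_mul, coeff_mul]
        refine sum_congr rfl fun p hp => ?_
        rw [ih p.1 (by have := mem_antidiagonal.1 hp; omega)]
      rw [← hF, ← hG, coeff_derivative, coeff_derivative] at h
      rw [← Nat.cast_succ, mul_comm, ← nsmul_eq_mul, mul_comm, ← nsmul_eq_mul] at h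
      exact (smul_right_inj (Nat.succ_ne_zero n)).mp h

variable [Algebra ℚ R]

/-- The generating series `exp (∑ u_j z ^ j)` of the complete homogeneous functions at `u`. -/
noncomputable def expSeries (u : ℕ+ → R) : PowerSeries R :=
  (PowerSeries.exp R).subst (satoSeriesAt u)

theorem derivative_expSeries (u : ℕ+ → R) :
    d⁄dX R (expSeries u) = expSeries u * d⁄dX R (satoSeriesAt u) := by
  rw [expSeries, derivative_subst (hasSubst_satoSeriesAt u), derivative_exp]

theorem constantCoeff_expSeries (u : ℕ+ → R) : constantCoeff (expSeries u) = 1 := by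
  have h := constantCoeff_subst_eq_zero (constantCoeff_satoSeriesAt u) (PowerSeries.exp R - 1)
    (by simp)
  rw [subst_sub (hasSubst_satoSeriesAt u)] at h
  have h1 : (1 : PowerSeries R).subst (satoSeriesAt u) = (1 : PowerSeries R) := by
    rw [← coe_substAlgHom (hasSubst_satoSeriesAt u), map_one]
  rw [h1] at h
  have h2 : constantCoeff (expSeries u - 1) = 0 := h
  rw [map_sub, map_one] at h2
  exact sub_eq_zero.1 h2

/-- Both sides have constant term 1 and the same logarithmic derivative. -/
theorem expSeries_add (u v : ℕ+ → R) : expSeries (u + v) = expSeries u * expSeries v := by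
  have : IsAddTorsionFree R := IsAddTorsionFree.of_module_rat R
  refine eq_of_derivative_eq_mul (derivative_expSeries _) ?_ ?_
  · rw [Derivation.leibniz, derivative_expSeries, derivative_expSeries, satoSeriesAt_add, map_add]
    simp only [smul_eq_mul]
    ring
  · simp only [map_mul, constantCoeff_expSeries, mul_one]

end ExpSeries

/-! ### Coefficients with integer index -/

section IntCoeff

variable {R : Type*} [CommRing R]

/-- The coefficient of `z ^ k` in a power series, which is `0` for `k < 0`. -/
noncomputable def intCoeff (F : PowerSeries R) (k : ℤ) : R :=
  if 0 ≤ k then coeff k.toNat F else 0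

theorem intCoeff_of_neg (F : PowerSeries R) {k : ℤ} (hk : k < 0) : intCoeff F k = 0 :=
  if_neg (by omega)

theorem intCoeff_zero (F : PowerSeries R) : intCoeff F 0 = constantCoeff F := by
  simp [intCoeff]

theorem intCoeff_one (k : ℤ) : intCoeff (1 : PowerSeries R) k = if k = 0 then 1 else 0 := by
  rw [intCoeff]
  split_ifs with h1 h2 h2
  · simp [h2]
  · rw [coeff_one, if_neg (by omega)]
  · omega
  · rfl

theorem intCoeff_sub_natCast (F : PowerSeries R) (a j : ℕ) :
    intCoeff F ((a : ℤ) - j) = coeff a (X ^ j * F) := by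
  rw [coeff_X_pow_mul', intCoeff]
  split_ifs with h1 h2 h2
  · congr; omega
  · omega
  · omega
  · rfl

/-- Multiplying a series by `G` amounts to multiplying its row of coefficients by the Toeplitz
matrix of `G`. -/
theorem intCoeff_mul_sub_natCast (F G : PowerSeries R) {N : ℕ} (a : Fin N) (j : ℕ) :
    intCoeff (F * G) ((a : ℤ) - j) =
      ∑ b : Fin N, intCoeff F ((b : ℤ) - j) * intCoeff G ((a : ℤ) - (b : ℤ)) := by
  rw [Fin.sum_univ_eq_sum_range
    (fun b => intCoeff F ((b : ℤ) - j) * intCoeff G (((a : ℕ) : ℤ) - (b : ℤ))) N,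
    intCoeff_sub_natCast, ← mul_assoc, coeff_mul, Nat.sum_antidiagonal_eq_sum_range_succ_mk]
  symm
  rw [← sum_subset (range_subset_range.2 (Nat.succ_le_of_lt a.2))]
  · refine sum_congr rfl fun b hb => ?_
    have := mem_range.1 hb
    rw [intCoeff_sub_natCast, intCoeff, if_pos (by omega),
      show (((a : ℕ) : ℤ) - (b : ℤ)).toNat = a - b by omega]
  · intro b _ hb
    have hab : (a : ℕ) < b := by simpa using hb
    rw [intCoeff_of_neg G (by omega), mul_zero]

end IntCoeff

/-! ### Schur functions as Jacobi–Trudi determinants of arbitrary size -/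

section SchurDet

variable {R : Type*} [CommRing R]

/-- The Jacobi–Trudi determinant of size `n` of the sequence `p`, for the generating series `F`. -/
noncomputable def jacobiTrudi (F : PowerSeries R) (p : ℕ → ℕ) (n : ℕ) : R :=
  Matrix.det (Matrix.of fun i j : Fin n => intCoeff F ((p i : ℤ) - (i : ℤ) + (j : ℤ)))

/-- A zero part in row `i` gives the entries `h_{j - i}`, so the extra rows vanish in the first `c`
columns and are unitriangular in the others. Padding by zeros lets all Schur functions be compared
with minors of a prescribed size. -/
theorem jacobiTrudi_eq_of_le {F : PowerSeries R} (hF : constantCoeff F = 1) {p : ℕ → ℕ} {c n : ℕ}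
    (hp : ∀ i, c ≤ i → p i = 0) (hn : c ≤ n) : jacobiTrudi F p n = jacobiTrudi F p c := by
  obtain ⟨d, rfl⟩ := Nat.exists_eq_add_of_le hn
  rw [jacobiTrudi, ← Matrix.det_submatrix_equiv_self (finSumFinEquiv (m := c) (n := d)),
    ← Matrix.fromBlocks_toBlocks (Matrix.submatrix _ _ _)]
  have h21 : (Matrix.submatrix (Matrix.of fun i j : Fin (c + d) =>
      intCoeff F ((p i : ℤ) - (i : ℤ) + (j : ℤ))) finSumFinEquiv finSumFinEquiv).toBlocks₂₁ = 0 := by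
    ext i j
    simp only [Matrix.toBlocks₂₁, Matrix.submatrix_apply, Matrix.of_apply,
      finSumFinEquiv_apply_left, finSumFinEquiv_apply_right, Fin.val_natAdd, Fin.val_castAdd,
      Matrix.zero_apply]
    rw [hp _ (Nat.le_add_right _ _)]
    exact intCoeff_of_neg F (by push_cast; omega)
  have h22 : (Matrix.submatrix (Matrix.of fun i j : Fin (c + d) =>
      intCoeff F ((p i : ℤ) - (i : ℤ) + (j : ℤ))) finSumFinEquiv finSumFinEquiv).toBlocks₂₂.det
      = 1 := by
    rw [Matrix.det_of_isUpperTriangular]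
    · refine prod_eq_one fun i _ => ?_
      simp only [Matrix.toBlocks₂₂, Matrix.submatrix_apply, Matrix.of_apply,
        finSumFinEquiv_apply_right, Fin.val_natAdd]
      rw [hp _ (Nat.le_add_right _ _), ← hF, ← intCoeff_zero]
      congr 1
      push_cast
      ring
    · intro i j hij
      simp only [Matrix.toBlocks₂₂, Matrix.submatrix_apply, Matrix.of_apply,
        finSumFinEquiv_apply_right, Fin.val_natAdd]
      rw [hp _ (Nat.le_add_right _ _)]
      have hij' : j < i := hij
      exact intCoeff_of_neg F (by push_cast; omega)
  rw [h21, Matrix.det_fromBlocks_zero₂₁, h22, mul_one]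
  rfl

variable [Algebra ℚ R]

theorem aeval_completeHomogeneous (u : ℕ+ → R) (k : ℤ) :
    MvPolynomial.aeval u (completeHomogeneous k) = intCoeff (expSeries u) k := by
  rw [completeHomogeneous, intCoeff]
  split_ifs with hk
  · have hs : HasSubst satoSeries := HasSubst.of_constantCoeff_zero' (by
      rw [← coeff_zero_eq_constantCoeff_apply, satoSeries, coeff_mk]
      simp)
    have h := map_subst hs (h := (MvPolynomial.aeval u : MvPolynomial ℕ+ ℚ →ₐ[ℚ] R).toRingHom)
      (PowerSeries.exp (MvPolynomial ℕ+ ℚ))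
    have h1 : PowerSeries.map (MvPolynomial.aeval u : MvPolynomial ℕ+ ℚ →ₐ[ℚ] R).toRingHom
        satoSeries = satoSeriesAt u := by
      ext j
      rw [coeff_map, satoSeries, satoSeriesAt, coeff_mk, coeff_mk]
      split_ifs
      · exact MvPolynomial.aeval_X u _
      · exact map_zero _
    rw [map_exp] at h
    have h2 := congrArg (PowerSeries.coeff k.toNat) h
    rw [show MvPowerSeries.map _ satoSeries = _ from h1] at h2
    rw [expSeries, ← h2]
    exact (coeff_map _ _ _).symm
  · simp

theorem aeval_schur (u : ℕ+ → R) (lam : YoungDiagram) {n : ℕ} (hn : lam.colLen 0 ≤ n) :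
    MvPolynomial.aeval u (schur lam) = jacobiTrudi (expSeries u) lam.rowLen n := by
  rw [jacobiTrudi_eq_of_le (constantCoeff_expSeries u) (fun i hi => ?_) hn, schur, jacobiTrudi,
    AlgHom.map_det]
  · congr 1
    ext i j
    exact aeval_completeHomogeneous u _
  · by_contra h
    have := YoungDiagram.mem_iff_lt_colLen.1 (YoungDiagram.mem_iff_lt_rowLen.2 (Nat.pos_of_ne_zero h))
    omega

end SchurDet

/-! ### Laplace expansion along the first rows -/

section Laplace

variable {R : Type*} [CommRing R]

/-- The determinant of a square matrix is the sum, over the sets `A` of `k = #s` columns,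
of the determinants of the matrices in which the rows in `s` are restricted to the columns in `A`
and the other rows to the columns outside `A`. -/
theorem det_eq_sum_det_restrict {α : Type*} [Fintype α] [DecidableEq α] (M : Matrix α α R)
    {s : Finset α} {k : ℕ} (hs : #s = k) :
    M.det = ∑ A : {A : Finset α // #A = k},
      Matrix.det (Matrix.of fun i j => if i ∈ s ↔ j ∈ A.1 then M i j else 0) := by
  rw [← Matrix.det_transpose]
  simp_rw [← Matrix.det_transpose (Matrix.of _), Matrix.det_apply]
  rw [sum_comm]
  refine sum_congr rfl fun σ _ => ?_
  rw [← smul_sum]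
  congr 1
  have hc : #(s.map σ.toEmbedding) = k := (card_map _).trans hs
  -- For fixed `σ` only `A = σ(s)` contributes: any other `A` of that size misses some `σ i` with `i
  -- ∈ s`, which makes a factor zero.
  rw [sum_eq_single_of_mem (⟨_, hc⟩ : {A : Finset α // #A = k}) (mem_univ _)]
  · refine prod_congr rfl fun i _ => ?_
    simp only [Matrix.transpose_apply, Matrix.of_apply]
    rw [if_pos]
    simp
  · intro A _ hA
    have hex : ∃ i ∈ s, σ i ∉ A.1 := by
      by_contra! hcon
      refine hA (Subtype.ext (eq_of_subset_of_card_le ?_ ?_).symm)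
      · intro x hx
        obtain ⟨i, hi, rfl⟩ := mem_map.1 hx
        exact hcon i hi
      · rw [hc, A.2]
    obtain ⟨i, his, hi⟩ := hex
    refine prod_eq_zero (mem_univ i) ?_
    simp [hi, his]

/-- The sign of a permutation of `Fin N` that is increasing on the preimage of `A` and on its
complement, and maps an initial segment onto `A`. -/
theorem sign_eq_of_monotoneOn {N : ℕ} (σ : Equiv.Perm (Fin N)) (A : Finset (Fin N))
    (hmono : ∀ i j, i < j → (σ i ∈ A ↔ σ j ∈ A) → σ i < σ j)
    (hinit : ∀ i j, σ i ∈ A → σ j ∉ A → i < j) :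
    Equiv.Perm.sign σ = (-1) ^ ∑ a ∈ A, #(Iio a \ A) := by
  -- The values forming an inversion with an earlier `σ i` are those below `σ i` outside `A` if `σ i
  -- ∈ A`, and there are none otherwise.
  have hinv : ∀ i, ((Ioi i).filter fun j => ¬ σ i < σ j).map σ.toEmbedding =
      if σ i ∈ A then Iio (σ i) \ A else ∅ := by
    intro i
    ext b
    obtain ⟨j, rfl⟩ := σ.surjective b
    have h1 := hmono i j
    have h2 := hmono j i
    have h3 := hinit i j
    have h4 := hinit j i
    have h5 : σ i = σ j ↔ i = j := σ.injective.eq_iff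
    simp only [mem_map_equiv, Equiv.symm_apply_apply, mem_filter, mem_Ioi]
    split_ifs with hi
    · simp only [mem_sdiff, mem_Iio]
      grind
    · simp only [notMem_empty, iff_false]
      grind
  rw [Equiv.Perm.sign_eq_prod_prod_Ioi]
  simp_rw [prod_ite, prod_const_one, prod_const, one_mul]
  rw [prod_pow_eq_pow_sum]
  congr 1
  have hcard : ∀ i, #((Ioi i).filter fun j => ¬ σ i < σ j) =
      if σ i ∈ A then #(Iio (σ i) \ A) else 0 := by
    intro i
    rw [← card_map σ.toEmbedding, hinv]
    split_ifs <;> simp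
  simp_rw [hcard]
  rw [Equiv.sum_comp σ (fun a => if a ∈ A then #(Iio a \ A) else 0), ← sum_filter]
  simp

/-- Laplace expansion of a determinant along its first `m` rows. -/
theorem det_eq_sum_mul_det_minors {m n : ℕ} (M : Matrix (Fin (m + n)) (Fin (m + n)) R) :
    M.det = ∑ A : {A : Finset (Fin (m + n)) // #A = m},
        (-1 : R) ^ (∑ a ∈ A.1, #(Iio a \ A.1)) *
          (M.submatrix (Fin.castAdd n) (A.1.orderEmbOfFin A.2)).det *
          (M.submatrix (Fin.natAdd m) (A.1ᶜ.orderEmbOfFin (k := n)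
            (by rw [card_compl, A.2, Fintype.card_fin]; omega))).det := by
  have hs : #((univ : Finset (Fin m)).map (Fin.castAddEmb n)) = m := by simp
  have hs1 : ∀ i : Fin m, Fin.castAdd n i ∈
      (univ : Finset (Fin m)).map (Fin.castAddEmb n) := fun i =>
    mem_map.2 ⟨i, mem_univ _, rfl⟩
  have hs2 : ∀ i : Fin n, Fin.natAdd m i ∉
      (univ : Finset (Fin m)).map (Fin.castAddEmb n) := by
    intro i hi
    obtain ⟨j, -, hj⟩ := mem_map.1 hi
    have h := congrArg Fin.val hj
    simp at h
    omega
  generalize (univ : Finset (Fin m)).map (Fin.castAddEmb n) = s at hs hs1 hs2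
  rw [det_eq_sum_det_restrict M hs]
  refine sum_congr rfl fun A _ => ?_
  have hA' : #A.1ᶜ = n := by rw [card_compl, A.2, Fintype.card_fin]; omega
  set e := finSumEquivOfFinset A.2 hA' with he
  have hl : ∀ i, e (Sum.inl i) = A.1.orderEmbOfFin A.2 i := finSumEquivOfFinset_inl A.2 hA'
  have hr : ∀ i, e (Sum.inr i) = A.1ᶜ.orderEmbOfFin hA' i := finSumEquivOfFinset_inr A.2 hA'
  have hlA : ∀ i, e (Sum.inl i) ∈ A.1 := fun i => by
    rw [hl]; exact orderEmbOfFin_mem _ _ _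
  have hrA : ∀ i, e (Sum.inr i) ∉ A.1 := fun i => by
    rw [hr]; exact mem_compl.1 (orderEmbOfFin_mem _ _ _)
  set σ : Equiv.Perm (Fin (m + n)) := finSumFinEquiv.symm.trans e with hσ
  have hsign : Equiv.Perm.sign σ = (-1) ^ ∑ a ∈ A.1, #(Iio a \ A.1) := by
    have hl' : ∀ i, σ (Fin.castAdd n i) = e (Sum.inl i) := fun i => by simp [hσ]
    have hr' : ∀ i, σ (Fin.natAdd m i) = e (Sum.inr i) := fun i => by simp [hσ]
    refine sign_eq_of_monotoneOn σ A.1 ?_ ?_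
    · intro i j
      induction i using Fin.addCases with
      | left i =>
        induction j using Fin.addCases with
        | left j =>
          rw [hl', hl', hl, hl]
          exact fun h _ => (A.1.orderEmbOfFin A.2).strictMono h
        | right j => simp [hl', hr', hlA, hrA]
      | right i =>
        induction j using Fin.addCases with
        | left j => simp [hl', hr', hlA, hrA]
        | right j =>
          rw [hr', hr', hr, hr]
          exact fun h _ => (A.1ᶜ.orderEmbOfFin hA').strictMono ((Fin.natAdd_lt_natAdd_iff _).1 h)
    · intro i j
      induction i using Fin.addCases with
      | left i =>
        induction j using Fin.addCases with
        | left j => simp [hl', hlA]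
        | right j => exact fun _ _ => Fin.lt_def.2 (by simp; omega)
      | right i => simp [hr', hrA]
  set N := Matrix.of fun i j => if i ∈ s ↔ j ∈ A.1 then M i j else 0 with hN
  -- Listing the columns in `A` first, then the others, makes `N` block diagonal; the sign of `σ` is
  -- squared away at the end.
  have hperm := Matrix.det_permute' σ N
  rw [← Matrix.det_submatrix_equiv_self finSumFinEquiv, Matrix.submatrix_submatrix] at hperm
  have hblocks : N.submatrix (id ∘ finSumFinEquiv) (σ ∘ finSumFinEquiv) =
      Matrix.fromBlocks (M.submatrix (Fin.castAdd n) (A.1.orderEmbOfFin A.2)) 0 0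
        (M.submatrix (Fin.natAdd m) (A.1ᶜ.orderEmbOfFin hA')) := by
    ext i j
    have hσ' : ∀ x, σ (finSumFinEquiv x) = e x := fun x => by simp [hσ]
    simp only [Matrix.submatrix_apply, Function.comp_apply, hσ', hN, Matrix.of_apply, id]
    rcases i with i | i <;> rcases j with j | j <;>
      simp [hs1, hs2, hlA, hrA] <;> simp [hl, hr]
  rw [hblocks, Matrix.det_fromBlocks_zero₂₁, hsign] at hperm
  rw [mul_assoc, hperm, ← mul_assoc]
  push_cast
  rw [← mul_pow]
  simp

end Laplace

/-! ### The stacked Toeplitz determinant -/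

section StackedToeplitz

variable {R : Type*} [CommRing R]

/-- The square matrix with the `m` rows of coefficients of `z ^ i * F` below `z ^ (m + n)`,
followed by the `n` rows of coefficients of `z ^ i * G`. -/
noncomputable def stackedToeplitz (F G : PowerSeries R) (m n : ℕ) :
    Matrix (Fin (m + n)) (Fin (m + n)) R :=
  Matrix.of fun i a => Fin.addCases (fun i : Fin m => intCoeff F ((a : ℤ) - ((i : ℕ) : ℤ)))
    (fun j : Fin n => intCoeff G ((a : ℤ) - ((j : ℕ) : ℤ))) i

theorem stackedToeplitz_castAdd (F G : PowerSeries R) {m n : ℕ} (i : Fin m) (a : Fin (m + n)) :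
    stackedToeplitz F G m n (Fin.castAdd n i) a = intCoeff F ((a : ℤ) - ((i : ℕ) : ℤ)) := by
  simp [stackedToeplitz]

theorem stackedToeplitz_natAdd (F G : PowerSeries R) {m n : ℕ} (j : Fin n) (a : Fin (m + n)) :
    stackedToeplitz F G m n (Fin.natAdd m j) a = intCoeff G ((a : ℤ) - ((j : ℕ) : ℤ)) := by
  simp [stackedToeplitz]

theorem det_toeplitz {F : PowerSeries R} (hF : PowerSeries.constantCoeff F = 1) (N : ℕ) :
    Matrix.det (Matrix.of fun b a : Fin N => intCoeff F ((a : ℤ) - (b : ℤ))) = 1 := by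
  rw [Matrix.det_of_isUpperTriangular]
  · refine prod_eq_one fun i _ => ?_
    rw [Matrix.of_apply, sub_self, intCoeff_zero, hF]
  · intro i j hij
    have hij' : j < i := hij
    exact intCoeff_of_neg F (by omega)

/-- Truncating to `m + n` columns loses nothing, because the Toeplitz matrix of `H` is upper
triangular. -/
theorem stackedToeplitz_mul (F G H : PowerSeries R) (m n : ℕ) :
    stackedToeplitz (F * H) (G * H) m n = stackedToeplitz F G m n *
      Matrix.of fun b a : Fin (m + n) => intCoeff H ((a : ℤ) - (b : ℤ)) := by
  ext i a
  rw [Matrix.mul_apply]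
  induction i using Fin.addCases with
  | left i =>
    simp only [stackedToeplitz_castAdd, Matrix.of_apply]
    exact intCoeff_mul_sub_natCast F H a i
  | right i =>
    simp only [stackedToeplitz_natAdd, Matrix.of_apply]
    exact intCoeff_mul_sub_natCast G H a i

theorem det_stackedToeplitz_one (G : PowerSeries R) (m n : ℕ) :
    (stackedToeplitz 1 G m n).det = jacobiTrudi G (fun i => if i < n then m else 0) n := by
  have hblocks : (stackedToeplitz 1 G m n).submatrix finSumFinEquiv finSumFinEquiv =
      Matrix.fromBlocks 1 0
        (Matrix.of fun (i : Fin n) (j : Fin m) => intCoeff G ((j : ℤ) - (i : ℤ)))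
        (Matrix.of fun i j : Fin n => intCoeff G ((m : ℤ) - (i : ℤ) + (j : ℤ))) := by
    ext i j
    rcases i with i | i <;> rcases j with j | j <;>
      simp only [Matrix.submatrix_apply, finSumFinEquiv_apply_left, finSumFinEquiv_apply_right,
        stackedToeplitz_castAdd, stackedToeplitz_natAdd, Matrix.fromBlocks_apply₁₁,
        Matrix.fromBlocks_apply₁₂, Matrix.fromBlocks_apply₂₁, Matrix.fromBlocks_apply₂₂,
        Matrix.of_apply, Fin.val_castAdd, Fin.val_natAdd, intCoeff_one, Matrix.one_apply,
        Matrix.zero_apply, Fin.ext_iff]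
    · refine if_congr ?_ rfl rfl
      omega
    · rw [if_neg]
      push_cast
      omega
    · congr 1
      push_cast
      ring
  rw [← Matrix.det_submatrix_equiv_self finSumFinEquiv, hblocks, Matrix.det_fromBlocks_zero₁₂,
    Matrix.det_one, one_mul, jacobiTrudi]
  congr 1
  ext i j
  simp

theorem det_stackedToeplitz_mul {F : PowerSeries R} (hF : PowerSeries.constantCoeff F = 1)
    (G : PowerSeries R) (m n : ℕ) :
    (stackedToeplitz F (G * F) m n).det =
      jacobiTrudi G (fun i => if i < n then m else 0) n := by
  have h := stackedToeplitz_mul 1 G F m n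
  rw [one_mul] at h
  rw [h, Matrix.det_mul, det_toeplitz hF, mul_one, det_stackedToeplitz_one]

end StackedToeplitz

/-! ### Beta sets, partitions and minors -/

section BetaSets

theorem card_eq_sum_rowLen (lam : YoungDiagram) {n : ℕ} (hn : lam.colLen 0 ≤ n) :
    lam.card = ∑ i ∈ range n, lam.rowLen i := by
  have h := card_eq_sum_card_fiberwise (s := lam.cells) (t := range n) (f := Prod.fst) (by
    rintro ⟨a, b⟩ hab
    have h0 : (a, 0) ∈ lam := lam.up_left_mem le_rfl (Nat.zero_le _) hab
    have := YoungDiagram.mem_iff_lt_colLen.1 h0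
    exact mem_coe.2 (mem_range.2 (by omega)))
  refine h.trans (sum_congr rfl fun i _ => ?_)
  rw [YoungDiagram.rowLen_eq_card]
  rfl

theorem colLen_le_of_rowLen_eq_zero {lam : YoungDiagram} {n : ℕ} (h : lam.rowLen n = 0) :
    lam.colLen 0 ≤ n := by
  by_contra! hn
  have := YoungDiagram.mem_iff_lt_rowLen.1 (YoungDiagram.mem_iff_lt_colLen.2 hn)
  omega

theorem rowLen_ofBetaSet_of_le (B : Finset ℕ) {i : ℕ} (hi : #B ≤ i) :
    (ofBetaSet B).rowLen i = 0 := by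
  by_contra h
  obtain ⟨h1, -⟩ := YoungDiagram.mem_ofRowLens.1
    (YoungDiagram.mem_iff_lt_rowLen.2 (Nat.pos_of_ne_zero h))
  simp at h1
  omega

theorem colLen_ofBetaSet_le (B : Finset ℕ) : (ofBetaSet B).colLen 0 ≤ #B :=
  colLen_le_of_rowLen_eq_zero (rowLen_ofBetaSet_of_le B le_rfl)

theorem rowLen_ofBetaSet {B : Finset ℕ} {m : ℕ} (hB : #B = m) (i : Fin m) :
    (ofBetaSet B).rowLen i = #(range (B.orderEmbOfFin hB i.rev) \ B) := by
  have hlen : (B.sort (· ≥ ·)).length = m := by rw [length_sort, hB]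
  have hsort : (fun i : Fin m => (B.sort (· ≥ ·))[(i.rev : ℕ)]'(by omega)) =
      B.orderEmbOfFin hB := by
    refine orderEmbOfFin_unique hB (fun i => (mem_sort (· ≥ ·)).1 (List.getElem_mem _)) ?_
    intro i j hij
    have h1 := List.pairwise_iff_getElem.1 (pairwise_sort B (· ≥ ·)) j.rev i.rev (by omega)
      (by omega) (Fin.rev_lt_rev.2 hij)
    refine lt_of_le_of_ne h1 fun h => ?_
    have h2 := (List.Nodup.getElem_inj_iff (sort_nodup B (· ≥ ·))).1 h
    exact hij.ne (Fin.rev_injective (Fin.ext h2))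
  rw [← congrFun hsort i.rev]
  have h := YoungDiagram.rowLen_ofRowLens (w := (B.sort (· ≥ ·)).map fun b => #(range b \ B))
    (hw := by
      refine List.Pairwise.sortedGE (List.pairwise_map.2 ((pairwise_sort B (· ≥ ·)).imp ?_))
      intro a b hab
      exact card_le_card (sdiff_subset_sdiff (range_subset_range.2 hab) Subset.rfl))
    ⟨i, by rw [List.length_map, hlen]; exact i.2⟩
  rw [ofBetaSet, h]
  simp

/-- Exactly `k` elements of `B` lie below its `k`-th one (from 0); all other smaller numbers are
holes. -/
theorem card_range_orderEmbOfFin_sdiff {B : Finset ℕ} {m : ℕ} (hB : #B = m) (k : Fin m) :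
    #(range (B.orderEmbOfFin hB k) \ B) + k = B.orderEmbOfFin hB k := by
  have h : range (B.orderEmbOfFin hB k) ∩ B = (Iio k).map (B.orderEmbOfFin hB).toEmbedding := by
    ext b
    simp only [mem_inter, mem_range, mem_map, mem_Iio]
    constructor
    · rintro ⟨h1, h2⟩
      rw [← mem_coe, ← range_orderEmbOfFin B hB] at h2
      obtain ⟨j, rfl⟩ := h2
      exact ⟨j, (B.orderEmbOfFin hB).lt_iff_lt.1 h1, rfl⟩
    · rintro ⟨j, h1, rfl⟩
      exact ⟨(B.orderEmbOfFin hB).lt_iff_lt.2 h1, orderEmbOfFin_mem _ _ _⟩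
  have h2 := card_sdiff_add_card_inter (range (B.orderEmbOfFin hB k)) B
  rwa [h, card_map, Fin.card_Iio, card_range] at h2

theorem card_ofBetaSet (B : Finset ℕ) : (ofBetaSet B).card = ∑ b ∈ B, #(range b \ B) := by
  rw [card_eq_sum_rowLen _ (colLen_ofBetaSet_le B), ← Fin.sum_univ_eq_sum_range]
  simp_rw [rowLen_ofBetaSet (rfl : #B = #B)]
  refine (Equiv.sum_comp Fin.revPerm (fun i => #(range (B.orderEmbOfFin rfl i) \ B))).trans ?_
  conv_rhs => rw [← map_orderEmbOfFin_univ B rfl]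
  rw [sum_map]
  simp

/-- Reversing rows and columns together costs no sign. It turns `lam_i - i + j` into a beta number
minus an index, so that after transposition this is a minor of a Toeplitz matrix. -/
theorem jacobiTrudi_ofBetaSet {R : Type*} [CommRing R] (F : PowerSeries R) {B : Finset ℕ} {m : ℕ}
    (hB : #B = m) : jacobiTrudi F (ofBetaSet B).rowLen m =
      Matrix.det (Matrix.of fun i j : Fin m =>
        intCoeff F ((B.orderEmbOfFin hB j : ℤ) - ((i : ℕ) : ℤ))) := by
  rw [← Matrix.det_transpose (Matrix.of fun i j : Fin m => intCoeff F _),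
    ← Matrix.det_submatrix_equiv_self Fin.revPerm, jacobiTrudi]
  congr 1
  ext i j
  simp only [Matrix.of_apply, Matrix.submatrix_apply, Matrix.transpose_apply, Fin.revPerm_apply]
  have h := card_range_orderEmbOfFin_sdiff hB i.rev
  rw [← rowLen_ofBetaSet hB i] at h
  congr 1
  rw [← h]
  simp only [Fin.val_rev]
  omega

theorem aeval_schur_ofBetaSet {R : Type*} [CommRing R] [Algebra ℚ R] (u : ℕ+ → R)
    {B : Finset ℕ} {m : ℕ} (hB : #B = m) :
    MvPolynomial.aeval u (schur (ofBetaSet B)) = Matrix.det (Matrix.of fun i j : Fin m =>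
      intCoeff (expSeries u) ((B.orderEmbOfFin hB j : ℤ) - ((i : ℕ) : ℤ))) := by
  rw [aeval_schur u _ ((colLen_ofBetaSet_le B).trans hB.le), jacobiTrudi_ofBetaSet _ hB]

theorem orderEmbOfFin_map_val {N m : ℕ} (A : Finset (Fin N)) (hA : #A = m)
    (hA' : #(A.map Fin.valEmbedding) = m) (i : Fin m) :
    (A.map Fin.valEmbedding).orderEmbOfFin hA' i = A.orderEmbOfFin hA i := by
  refine (congrFun (orderEmbOfFin_unique hA' (f := fun i => (A.orderEmbOfFin hA i : ℕ))
    (fun i => mem_map_of_mem Fin.valEmbedding (orderEmbOfFin_mem _ _ _)) ?_) i).symm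
  exact fun i j hij => (A.orderEmbOfFin hA).strictMono hij

theorem card_range_val_sdiff_map {N : ℕ} (A : Finset (Fin N)) (a : Fin N) :
    #(range a \ A.map Fin.valEmbedding) = #(Iio a \ A) := by
  rw [← card_map Fin.valEmbedding, Finset.map_sdiff]
  congr 2
  ext b
  simp only [mem_range, mem_map, mem_Iio, Fin.valEmbedding_apply]
  exact ⟨fun h => ⟨⟨b, h.trans a.2⟩, h, rfl⟩, fun ⟨c, hc, hb⟩ => hb ▸ hc⟩

/-- Identifies the exponent of the Laplace sign with the size of a partition. -/
theorem card_ofBetaSet_map_val {N : ℕ} (A : Finset (Fin N)) :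
    (ofBetaSet (A.map Fin.valEmbedding)).card = ∑ a ∈ A, #(Iio a \ A) := by
  rw [card_ofBetaSet, sum_map]
  exact sum_congr rfl fun a _ => card_range_val_sdiff_map A a

end BetaSets

/-- The expansion of the Schur function of a rectangle at a difference of variables, indexed by the
beta sets of the diagrams contained in the rectangle. -/
theorem sum_schur_mul_schur_compl {R : Type*} [CommRing R] [Algebra ℚ R] (u v : ℕ+ → R)
    (m n : ℕ) :
    ∑ A : {A : Finset (Fin (m + n)) // #A = m},
        (-1 : R) ^ (ofBetaSet (A.1.map Fin.valEmbedding)).card *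
          MvPolynomial.aeval u (schur (ofBetaSet (A.1ᶜ.map Fin.valEmbedding))) *
          MvPolynomial.aeval v (schur (ofBetaSet (A.1.map Fin.valEmbedding))) =
      MvPolynomial.aeval (u - v) (schur (rectangle n m)) := by
  have hrow : (rectangle n m).rowLen = fun i => if i < n then m else 0 := by
    ext i
    refine eq_of_forall_lt_iff fun j => ?_
    rw [← YoungDiagram.mem_iff_lt_rowLen, ← YoungDiagram.mem_cells]
    simp only [rectangle, mem_product, mem_range]
    split_ifs with h <;> simp [h]
  -- Read from right to left: the rectangle's determinant becomes the stacked one for `expSeries v`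
  -- and `expSeries (u - v + v)`.
  rw [aeval_schur _ _ (colLen_le_of_rowLen_eq_zero (n := n) (by simp [hrow])), hrow,
    ← det_stackedToeplitz_mul (constantCoeff_expSeries v), ← expSeries_add, sub_add_cancel,
    det_eq_sum_mul_det_minors]
  refine sum_congr rfl fun A _ => ?_
  have hA' : #A.1ᶜ = n := by rw [card_compl, A.2, Fintype.card_fin]; omega
  rw [card_ofBetaSet_map_val, mul_right_comm,
    aeval_schur_ofBetaSet v ((card_map _).trans A.2),
    aeval_schur_ofBetaSet u ((card_map _).trans hA')]
  refine congrArg₂ _ (congrArg _ ?_) ?_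
  · refine congrArg Matrix.det (Matrix.ext fun i j => ?_)
    rw [Matrix.of_apply, Matrix.submatrix_apply, stackedToeplitz_castAdd,
      orderEmbOfFin_map_val A.1 A.2]
  · refine congrArg Matrix.det (Matrix.ext fun i j => ?_)
    rw [Matrix.of_apply, Matrix.submatrix_apply, stackedToeplitz_natAdd,
      orderEmbOfFin_map_val A.1ᶜ hA']

/-! ### Corners of the staircase and the 2-abacus -/

section Corners

/-- The diagram obtained from the staircase `Δ_l` by adding the corners `(l - a, a)` for those
`a ≤ l` that belong to `A`. -/
def addCorners (l : ℕ) (A : Finset ℕ) : YoungDiagram where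
  cells := (range (l + 1) ×ˢ range (l + 1)).filter fun c =>
    c.1 + c.2 < l ∨ (c.1 + c.2 = l ∧ c.2 ∈ A)
  isLowerSet := by
    rintro ⟨a, b⟩ ⟨c, d⟩ ⟨h1, h2⟩ h
    simp only [coe_filter, mem_product, mem_range, Set.mem_ofPred_eq] at h h1 h2 ⊢
    refine ⟨by omega, ?_⟩
    by_cases hs : c + d < l
    · exact Or.inl hs
    · obtain ⟨rfl, rfl⟩ : c = a ∧ d = b := by omega
      exact h.2

theorem mem_addCorners {l : ℕ} {A : Finset ℕ} {c : ℕ × ℕ} :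
    c ∈ addCorners l A ↔ c.1 + c.2 < l ∨ (c.1 + c.2 = l ∧ c.2 ∈ A) := by
  rw [← YoungDiagram.mem_cells, addCorners, mem_filter, mem_product, mem_range, mem_range]
  constructor
  · exact fun h => h.2
  · exact fun h => ⟨by omega, h⟩

theorem mem_staircase {l : ℕ} {c : ℕ × ℕ} : c ∈ staircase l ↔ c.1 + c.2 < l := by
  rw [← YoungDiagram.mem_cells, staircase, mem_filter, mem_product, mem_range, mem_range]
  omega

theorem rowLen_addCorners {l : ℕ} {A : Finset ℕ} {i : ℕ} (hi : i ≤ l) :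
    (addCorners l A).rowLen i = l - i + if l - i ∈ A then 1 else 0 := by
  refine eq_of_forall_lt_iff fun j => ?_
  rw [← YoungDiagram.mem_iff_lt_rowLen, mem_addCorners]
  rcases lt_trichotomy j (l - i) with h | rfl | h
  · have : i + j < l := by omega
    simp only [this, true_or, true_iff]
    omega
  · have h1 : i + (l - i) = l := by omega
    simp only [h1, lt_irrefl, true_and, false_or]
    split_ifs with h2 <;> simp [h2]
  · have h1 : ¬ (i + j < l) := by omega
    have h2 : i + j ≠ l := by omega
    simp only [h1, h2, false_and, or_self, false_iff]
    split_ifs <;> omega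

/-- Row `l - a` has length `a`, plus 1 if `a ∈ A`, and its beta shift is again `a`. -/
theorem betaSet_addCorners (l : ℕ) (A : Finset ℕ) :
    betaSet (l + 1) (addCorners l A) =
      (range (l + 1)).image fun a => 2 * a + if a ∈ A then 1 else 0 := by
  have h : range (l + 1) = (range (l + 1)).image fun i => l - i := by
    ext a
    simp only [mem_image, mem_range]
    exact ⟨fun ha => ⟨l - a, by omega, by omega⟩, fun ⟨i, hi, ha⟩ => by omega⟩
  conv_rhs => rw [h, image_image]
  refine image_congr fun i hi => ?_
  have hi' : i < l + 1 := by simpa using hi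
  simp only [Function.comp_apply]
  rw [rowLen_addCorners (by omega)]
  omega

/-- There are `l` or `l + 1` rows; as `l` is odd, both round up to `l + 1` beads. -/
theorem ceilDiv_colLen_addCorners {l : ℕ} (hl : Odd l) (A : Finset ℕ) :
    2 * ((addCorners l A).colLen 0 ⌈/⌉ 2) = l + 1 := by
  have h1 : (addCorners l A).colLen 0 ≤ l + 1 := by
    by_contra! h
    have := mem_addCorners.1 (YoungDiagram.mem_iff_lt_colLen.2 h)
    omega
  have h2 : l ≤ (addCorners l A).colLen 0 := by
    by_contra! h
    have := YoungDiagram.mem_iff_lt_colLen.1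
      ((mem_addCorners (A := A) (c := ((addCorners l A).colLen 0, 0))).2 (Or.inl h))
    omega
  obtain ⟨k, rfl⟩ := hl
  rw [Nat.ceilDiv_eq_add_pred_div]
  omega

theorem quotient_one_addCorners {l : ℕ} (hl : Odd l) {A : Finset ℕ} (hA : A ⊆ range (l + 1)) :
    quotient 2 1 (addCorners l A) = ofBetaSet A := by
  rw [quotient, ceilDiv_colLen_addCorners hl, betaSet_addCorners, runner]
  congr 1
  ext a
  simp only [mem_image, mem_filter, mem_range]
  constructor
  · rintro ⟨b, ⟨⟨c, hc, rfl⟩, h⟩, rfl⟩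
    split_ifs at h ⊢ with hcA
    · rwa [show (2 * c + 1) / 2 = c by omega]
    · omega
  · intro ha
    exact ⟨2 * a + 1, ⟨⟨a, mem_range.1 (hA ha), by rw [if_pos ha]⟩, by omega⟩, by omega⟩

theorem quotient_zero_addCorners {l : ℕ} (hl : Odd l) (A : Finset ℕ) :
    quotient 2 0 (addCorners l A) = ofBetaSet (range (l + 1) \ A) := by
  rw [quotient, ceilDiv_colLen_addCorners hl, betaSet_addCorners, runner]
  congr 1
  ext a
  simp only [mem_image, mem_filter, mem_range, mem_sdiff]
  constructor
  · rintro ⟨b, ⟨⟨c, hc, rfl⟩, h⟩, rfl⟩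
    split_ifs at h ⊢ with hcA
    · omega
    · rw [show (2 * c + 0) / 2 = c by omega]
      exact ⟨hc, hcA⟩
  · rintro ⟨ha, haA⟩
    exact ⟨2 * a, ⟨⟨a, ha, by rw [if_neg haA, add_zero]⟩, by omega⟩, by omega⟩

theorem cells_addCorners_sdiff {l : ℕ} {A : Finset ℕ} (hA : A ⊆ range (l + 1)) :
    (addCorners l A).cells \ (staircase l).cells = A.image fun a => (l - a, a) := by
  ext ⟨x, y⟩
  simp only [mem_sdiff, YoungDiagram.mem_cells, mem_addCorners, mem_staircase, mem_image,
    Prod.mk.injEq]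
  constructor
  · rintro ⟨h | ⟨h1, h2⟩, h3⟩
    · exact absurd h h3
    · exact ⟨y, h2, by omega, rfl⟩
  · rintro ⟨a, ha, rfl, rfl⟩
    have := mem_range.1 (hA ha)
    exact ⟨Or.inr ⟨by omega, ha⟩, by omega⟩

theorem card_cells_addCorners_sdiff {l : ℕ} {A : Finset ℕ} (hA : A ⊆ range (l + 1)) :
    #((addCorners l A).cells \ (staircase l).cells) = #A := by
  rw [cells_addCorners_sdiff hA]
  exact card_image_of_injective _ fun a b h => (Prod.mk.inj h).2

theorem addCorners_injOn (l : ℕ) :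
    Set.InjOn (addCorners l) {A | A ⊆ range (l + 1)} := by
  intro A hA B hB h
  have h1 := cells_addCorners_sdiff hA
  rw [h, cells_addCorners_sdiff hB] at h1
  exact (image_injective (fun a b h => (Prod.mk.inj h).2) h1).symm

theorem staircase_le_addCorners (l : ℕ) (A : Finset ℕ) : staircase l ≤ addCorners l A :=
  fun _ hc => mem_addCorners.2 (Or.inl (mem_staircase.1 hc))

/-- For odd `l`, a diagram obtained from the staircase `Δ_l` by adding `1`-nodes is obtained by
adding corners. -/
theorem exists_eq_addCorners {l : ℕ} (hl : Odd l) {mu : YoungDiagram} (hle : staircase l ≤ mu)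
    (hlab : ∀ c ∈ mu.cells \ (staircase l).cells, nodeLabel c = 1) :
    ∃ A ⊆ range (l + 1), addCorners l A = mu := by
  obtain ⟨k, hk⟩ := hl
  have hsum : ∀ c ∈ mu, c.1 + c.2 ≤ l := by
    rintro ⟨x, y⟩ hc
    by_contra! h
    simp only at h
    -- A cell beyond the antidiagonal `x + y = l` forces one on `x + y = l + 1`, which is even, so
    -- that cell has label 0.
    have hmem : (min x (l + 1), l + 1 - min x (l + 1)) ∈ mu :=
      mu.up_left_mem (min_le_left _ _) (by omega) hc
    have := hlab _ (mem_sdiff.2 ⟨hmem, fun h' => by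
      have := mem_staircase.1 h'
      simp only at this
      omega⟩)
    simp only [nodeLabel] at this
    omega
  refine ⟨(range (l + 1)).filter fun a => (l - a, a) ∈ mu, filter_subset _ _, ?_⟩
  ext ⟨x, y⟩
  rw [YoungDiagram.mem_cells, YoungDiagram.mem_cells, mem_addCorners]
  simp only [mem_filter, mem_range]
  constructor
  · rintro (h | ⟨h1, -, h2⟩)
    · exact hle (mem_staircase.2 h)
    · rwa [show l - y = x by omega] at h2
  · intro h
    have := hsum _ h
    simp only at this
    by_cases h1 : x + y < l
    · exact Or.inl h1
    · refine Or.inr ⟨by omega, by omega, ?_⟩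
      rwa [show l - y = x by omega]

theorem mem_addedNodes_staircase {l : ℕ} (hl : Odd l) {m : ℕ} {mu : YoungDiagram} :
    mu ∈ addedNodes 1 m (staircase l) ↔
      ∃ A ⊆ range (l + 1), #A = m ∧ addCorners l A = mu := by
  rw [addedNodes, Set.Finite.mem_toFinset]
  constructor
  · rintro ⟨hle, hcard, hlab⟩
    obtain ⟨A, hA, rfl⟩ := exists_eq_addCorners hl hle hlab
    exact ⟨A, hA, by rw [← hcard, card_cells_addCorners_sdiff hA], rfl⟩
  · rintro ⟨A, hA, rfl, rfl⟩
    refine ⟨staircase_le_addCorners l A, card_cells_addCorners_sdiff hA, ?_⟩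
    rw [cells_addCorners_sdiff hA]
    intro c hc
    obtain ⟨a, ha, rfl⟩ := mem_image.1 hc
    have := mem_range.1 (hA ha)
    obtain ⟨k, rfl⟩ := hl
    simp only [nodeLabel]
    omega

theorem map_val_subset_range {N : ℕ} (A : Finset (Fin N)) :
    A.map Fin.valEmbedding ⊆ range N := by
  intro a ha
  obtain ⟨b, -, rfl⟩ := mem_map.1 ha
  exact mem_range.2 b.2

theorem sum_addedNodes_staircase {M : Type*} [AddCommMonoid M] {l : ℕ} (hl : Odd l) (m : ℕ)
    (f : YoungDiagram → M) :
    ∑ mu ∈ addedNodes 1 m (staircase l), f mu =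
      ∑ A : {A : Finset (Fin (l + 1)) // #A = m}, f (addCorners l (A.1.map Fin.valEmbedding)) := by
  symm
  refine sum_bij (fun A _ => addCorners l (A.1.map Fin.valEmbedding)) ?_ ?_ ?_ fun _ _ => rfl
  · intro A _
    exact (mem_addedNodes_staircase hl).2
      ⟨_, map_val_subset_range A.1, (card_map _).trans A.2, rfl⟩
  · intro A _ B _ h
    exact Subtype.ext (map_injective _
      (addCorners_injOn l (map_val_subset_range A.1) (map_val_subset_range B.1) h))
  · intro mu hmu
    obtain ⟨A, hA, hcard, rfl⟩ := (mem_addedNodes_staircase hl).1 hmu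
    have hmap : (A.attachFin fun a ha => mem_range.1 (hA ha)).map Fin.valEmbedding = A :=
      map_valEmbedding_attachFin _
    exact ⟨⟨_, (card_attachFin A _).trans hcard⟩, mem_univ _, by rw [hmap]⟩

theorem range_sdiff_map_val {N : ℕ} (A : Finset (Fin N)) :
    range N \ A.map Fin.valEmbedding = Aᶜ.map Fin.valEmbedding := by
  rw [compl_eq_univ_sdiff, Finset.map_sdiff, Fin.map_valEmbedding_univ, Nat.Iio_eq_range]

end Corners

end RectSchur

theorem theorem4p1 (l : ℕ) (hl : Odd l) (m : ℕ) (hm : m ≤ l)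
    {R : Type*} [CommRing R] [Algebra ℚ R] (u v : ℕ+ → R) :
    ∑ mu ∈ RectSchur.addedNodes 1 m (RectSchur.staircase l),
        (-1 : R) ^ (RectSchur.quotient 2 1 mu).card *
          MvPolynomial.aeval u (RectSchur.schur (RectSchur.quotient 2 0 mu)) *
          MvPolynomial.aeval v (RectSchur.schur (RectSchur.quotient 2 1 mu)) =
      MvPolynomial.aeval (u - v) (RectSchur.schur (RectSchur.rectangle (l + 1 - m) m)) := by
  obtain ⟨n, hn⟩ : ∃ n, l + 1 = m + n := Nat.exists_eq_add_of_le (by omega)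
  rw [RectSchur.sum_addedNodes_staircase hl, show l + 1 - m = n by omega,
    ← RectSchur.sum_schur_mul_schur_compl, ← hn]
  refine Finset.sum_congr rfl fun A _ => ?_
  rw [RectSchur.quotient_one_addCorners hl (RectSchur.map_val_subset_range A.1),
    RectSchur.quotient_zero_addCorners hl, RectSchur.range_sdiff_map_val]
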